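/- For a matrix $Z\in\mathbb{R}^{n\times 2}$ with rows $Z_i$ and labels $Y\in\{-1,1\}^n$, the logistic regression objective is $\mathcal{L}(\beta\mid Z,Y)=\sum_{i=1}^n \ln(1+\exp(-Y_iZ_i\beta))$, $\beta\in\mathbb{R}^2$. For $0<\varepsilon<1$, a $(1\pm\varepsilon)$-coreset of $(Z,Y)$ of size $k$ is a collection of arbitrary points $c_1,\dots,c_k\in\mathbb{R}^2$ (labels folded in; not necessarily derived from input points) with weights $u_1,\dots,u_k>0$ such that for all $\beta\in\mathbb{R}^2$ $$\Bigl|\mathcal{L}(\beta\mid Z,Y)-\sum_{j=1}^k u_j\ln(1+\exp(c_j\beta))\Bigr|\le \varepsilon\,\mathcal{L}(\beta\mid Z,Y).$$ In the worst case, any coreset for logistic regression in $2$-dimensional Euclidean space consists of $\Omega(n/\log n)$ points: there is an absolute constant $c>0$ such that for every $n\ge 2$ there is an instance $Z\in\mathbb{R}^{n\times 2}$, $Y\in\{-1,1\}^n$ with the property that, for every $\varepsilon\in(0,1)$, every $(1\pm\varepsilon)$-coreset of $(Z,Y)$ has size $k\ge c\,n/\log n$. -/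

import Mathlib

open scoped Matrix

namespace LogisticRegression

noncomputable section

/-- The logistic loss `g(z) = ln (1 + exp z)`. -/
def g (z : ℝ) : ℝ := Real.log (1 + Real.exp z)

/-- The weighted logistic objective `f_w(v) = ∑ i, w i * g (v i)`, evaluated at `v = X *ᵥ β`. -/
def f {m : ℕ} (w : Fin m → ℝ) (v : Fin m → ℝ) : ℝ := ∑ i, w i * g (v i)

/-- Folding the labels into the data: the matrix with rows `x i = - Y i • Z i`, so that
`f 1 (fold Z Y *ᵥ β) = ∑ i, ln (1 + exp (- Y i * (Z i ⬝ᵥ β)))` is the negative log-likelihood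
of the instance `Z, Y` at `β`. -/
def fold {n d : ℕ} (Z : Matrix (Fin n) (Fin d) ℝ) (Y : Fin n → ℝ) : Matrix (Fin n) (Fin d) ℝ :=
  Matrix.of fun i j => -(Y i) * Z i j

/-- The points (rows) of `C`, with positive weights `u`, form a `(1 ± ε)`-coreset of the points
(rows) of `X`, weighted by `w`, for logistic regression. The rows of `C` are arbitrary points,
not necessarily rows of `X`, and no bound on their number `k` is imposed. -/
def IsCoreset {n k d : ℕ} (ε : ℝ) (X : Matrix (Fin n) (Fin d) ℝ) (w : Fin n → ℝ)
    (C : Matrix (Fin k) (Fin d) ℝ) (u : Fin k → ℝ) : Prop :=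
  (∀ i, 0 < u i) ∧
    ∀ β : Fin d → ℝ, |f w (X *ᵥ β) - f u (C *ᵥ β)| ≤ ε * f w (X *ᵥ β)

end

end LogisticRegression

/-!
Along a ray `t • β` with `t → ∞`, a sum of logistic losses all of whose margins are negative decays
like `exp (t * s)`, where `s` is its largest margin. As the objectives of the input and of a coreset
are within constant factors of each other, their largest margins agree in every direction in which
the input has only negative margins. If every input point is the unique extreme one in such a
direction, the coreset points that attain these margins are pairwise distinct: a point attaining
them in two directions would be too extreme in the sum of the two. Points on a branch of a
hyperbola are extreme in this sense.
-/

open Asymptotics Filter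

namespace LogisticRegression

section Objective

variable {m l : ℕ} {w a : Fin m → ℝ} {u b : Fin l → ℝ} {s : ℝ}

theorem g_nonneg (z : ℝ) : 0 ≤ g z :=
  Real.log_nonneg (by linarith [Real.exp_pos z])

theorem g_mono : Monotone g := fun _ _ h =>
  Real.log_le_log (by positivity) (by gcongr)

theorem g_le_exp (z : ℝ) : g z ≤ Real.exp z :=
  (Real.log_le_sub_one_of_pos (by positivity)).trans_eq (add_sub_cancel_left _ _)

theorem exp_div_two_le_g {z : ℝ} (hz : z ≤ 0) : Real.exp z / 2 ≤ g z := by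
  have hexp : Real.exp z ≤ 1 := Real.exp_le_one_iff.2 hz
  refine le_trans ?_ (Real.le_log_one_add_of_nonneg (Real.exp_pos z).le)
  rw [div_le_div_iff₀ two_pos (by positivity)]
  nlinarith [Real.exp_pos z]

theorem f_nonneg (hw : ∀ i, 0 ≤ w i) (v : Fin m → ℝ) : 0 ≤ f w v :=
  Finset.sum_nonneg fun i _ => mul_nonneg (hw i) (g_nonneg _)

theorem mul_g_le_f (hw : ∀ i, 0 ≤ w i) (v : Fin m → ℝ) (i : Fin m) : w i * g (v i) ≤ f w v :=
  Finset.single_le_sum (f := fun i => w i * g (v i))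
    (fun j _ => mul_nonneg (hw j) (g_nonneg _)) (Finset.mem_univ i)

theorem f_smul_isLittleO_exp (hb : ∀ j, b j < s) :
    (fun t : ℝ => f u (t • b)) =o[atTop] fun t => Real.exp (t * s) := by
  refine IsLittleO.fun_sum fun j _ => IsLittleO.const_mul_left ?_ (u j)
  have hg : (fun t : ℝ => g ((t • b) j)) =O[atTop] fun t => Real.exp (t * b j) :=
    .of_norm_le fun t => (Real.norm_of_nonneg (g_nonneg _)).trans_le (g_le_exp _)
  refine hg.trans_isLittleO (Real.isLittleO_exp_comp_exp_comp.2 ?_)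
  simpa only [id, ← mul_sub] using tendsto_id.atTop_mul_const (sub_pos.2 (hb j))

theorem exp_isBigO_f_smul (hw : ∀ i, 0 ≤ w i) {i : Fin m} (hi : 0 < w i) (hs : s ≤ 0)
    (ha : s ≤ a i) : (fun t : ℝ => Real.exp (t * s)) =O[atTop] fun t => f w (t • a) := by
  refine .of_bound (2 / w i) ((eventually_ge_atTop 0).mono fun t ht => ?_)
  rw [Real.norm_of_nonneg (Real.exp_pos _).le, Real.norm_of_nonneg (f_nonneg hw _)]
  have hterm : w i * (Real.exp (t * s) / 2) ≤ f w (t • a) := calc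
    w i * (Real.exp (t * s) / 2) ≤ w i * g (t * s) := by
      gcongr; exact exp_div_two_le_g (mul_nonpos_of_nonneg_of_nonpos ht hs)
    _ ≤ w i * g ((t • a) i) := by gcongr; exact g_mono (mul_le_mul_of_nonneg_left ha ht)
    _ ≤ f w (t • a) := mul_g_le_f hw _ i
  calc Real.exp (t * s) = 2 / w i * (w i * (Real.exp (t * s) / 2)) := by field_simp
    _ ≤ 2 / w i * f w (t • a) := by gcongr

theorem exists_le_of_f_smul_isBigO (hw : ∀ i, 0 ≤ w i) {i : Fin m} (hi : 0 < w i) (hs : s ≤ 0)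
    (ha : s ≤ a i) (h : (fun t : ℝ => f w (t • a)) =O[atTop] fun t => f u (t • b)) :
    ∃ j, s ≤ b j := by
  by_contra! hb
  exact isLittleO_irrefl (.of_forall fun t => Real.exp_ne_zero (t * s))
    (((exp_isBigO_f_smul hw hi hs ha).trans h).trans_isLittleO (f_smul_isLittleO_exp hb))

end Objective

namespace IsCoreset

variable {n k d : ℕ} {ε : ℝ} {X : Matrix (Fin n) (Fin d) ℝ} {w : Fin n → ℝ}
  {C : Matrix (Fin k) (Fin d) ℝ} {u : Fin k → ℝ}

theorem isTheta (h : IsCoreset ε X w C u) (hw : ∀ i, 0 ≤ w i) (hε : ε < 1) :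
    (fun β => f w (X *ᵥ β)) =Θ[⊤] fun β => f u (C *ᵥ β) := by
  have hX (β : Fin d → ℝ) : 0 ≤ f w (X *ᵥ β) := f_nonneg hw _
  have hC (β : Fin d → ℝ) : 0 ≤ f u (C *ᵥ β) := f_nonneg (fun j => (h.1 j).le) _
  constructor
  · refine .of_bound (1 - ε)⁻¹ (.of_forall fun β => ?_)
    rw [Real.norm_of_nonneg (hX β), Real.norm_of_nonneg (hC β), le_inv_mul_iff₀ (sub_pos.2 hε)]
    linarith [(abs_le.1 (h.2 β)).2]
  · refine .of_bound (1 + ε) (.of_forall fun β => ?_)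
    rw [Real.norm_of_nonneg (hX β), Real.norm_of_nonneg (hC β)]
    linarith [(abs_le.1 (h.2 β)).1]

theorem isTheta_smul (h : IsCoreset ε X w C u) (hw : ∀ i, 0 ≤ w i) (hε : ε < 1)
    (β : Fin d → ℝ) :
    (fun t : ℝ => f w (t • X *ᵥ β)) =Θ[atTop] fun t => f u (t • C *ᵥ β) := by
  simp only [← Matrix.mulVec_smul]
  exact ⟨(h.isTheta hw hε).1.comp_tendsto tendsto_top, (h.isTheta hw hε).2.comp_tendsto tendsto_top⟩

theorem exists_le_mulVec_iff (h : IsCoreset ε X w C u) (hw : ∀ i, 0 < w i) (hε : ε < 1)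
    (β : Fin d → ℝ) {s : ℝ} (hs : s ≤ 0) :
    (∃ i, s ≤ (X *ᵥ β) i) ↔ ∃ j, s ≤ (C *ᵥ β) j := by
  have hw' (i : Fin n) : 0 ≤ w i := (hw i).le
  have hΘ := h.isTheta_smul hw' hε β
  exact ⟨fun ⟨i, hi⟩ => exists_le_of_f_smul_isBigO hw' (hw i) hs hi hΘ.1,
    fun ⟨j, hj⟩ => exists_le_of_f_smul_isBigO (fun j => (h.1 j).le) (h.1 j) hs hj hΘ.2⟩

theorem le_of_forall_mulVec_lt (h : IsCoreset ε X w C u) (hw : ∀ i, 0 < w i) (hε : ε < 1)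
    {β : Fin n → Fin d → ℝ} (hβ : ∀ i, (X *ᵥ β i) i ≤ 0)
    (hlt : ∀ i l, l ≠ i → (X *ᵥ β i) l < (X *ᵥ β i) i) : n ≤ k := by
  have hattained (i : Fin n) : ∃ j, (X *ᵥ β i) i ≤ (C *ᵥ β i) j :=
    (h.exists_le_mulVec_iff hw hε (β i) (hβ i)).1 ⟨i, le_rfl⟩
  choose φ hφ using hattained
  suffices hφ_inj : φ.Injective by simpa using Fintype.card_le_of_injective φ hφ_inj
  intro i i' hii'
  by_contra hne
  obtain ⟨l, hl⟩ : ∃ l, (X *ᵥ β i) i + (X *ᵥ β i') i' ≤ (X *ᵥ (β i + β i')) l := by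
    refine (h.exists_le_mulVec_iff hw hε _ (add_nonpos (hβ i) (hβ i'))).2 ⟨φ i, ?_⟩
    rw [Matrix.mulVec_add, Pi.add_apply]
    exact add_le_add (hφ i) (hii' ▸ hφ i')
  rw [Matrix.mulVec_add, Pi.add_apply] at hl
  rcases eq_or_ne l i with rfl | hli
  · linarith [hlt i' l hne]
  rcases eq_or_ne l i' with rfl | hli'
  · linarith [hlt i l hli]
  linarith [hlt i l hli, hlt i' l hli']

end IsCoreset

section Hyperbola

/-- The points `(exp (τ i), exp (-τ i))` on a branch of the hyperbola `x * y = 1`, which form the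
hard instance. The exponential parametrization turns inner products with normals of the hyperbola
into values of `cosh`. -/
noncomputable def hyperbolaPoints {n : ℕ} (τ : Fin n → ℝ) : Matrix (Fin n) (Fin 2) ℝ :=
  Matrix.of fun i => ![Real.exp (τ i), Real.exp (-τ i)]

/-- The normal vector of the hyperbola `x * y = 1` at `(exp s, exp (-s))` that points towards the
origin: the direction in which this point is extreme on its branch. -/
noncomputable def hyperbolaNormal (s : ℝ) : Fin 2 → ℝ :=
  ![-Real.exp (-s), -Real.exp s]

variable {n : ℕ} {τ : Fin n → ℝ}

theorem hyperbolaPoints_mulVec_normal (τ : Fin n → ℝ) (s : ℝ) (l : Fin n) :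
    (hyperbolaPoints τ *ᵥ hyperbolaNormal s) l = -(2 * Real.cosh (τ l - s)) := by
  simp only [hyperbolaPoints, hyperbolaNormal, Matrix.mulVec, dotProduct, Fin.sum_univ_two,
    Matrix.of_apply, Matrix.cons_val_zero, Matrix.cons_val_one, mul_neg, ← Real.exp_add,
    Real.cosh_eq]
  ring_nf

theorem IsCoreset.le_of_hyperbolaPoints {k : ℕ} {ε : ℝ} {w : Fin n → ℝ}
    {C : Matrix (Fin k) (Fin 2) ℝ} {u : Fin k → ℝ} (h : IsCoreset ε (hyperbolaPoints τ) w C u)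
    (hτ : τ.Injective) (hw : ∀ i, 0 < w i) (hε : ε < 1) : n ≤ k := by
  refine h.le_of_forall_mulVec_lt hw hε (β := fun i => hyperbolaNormal (τ i)) (fun i => ?_)
    fun i l hli => ?_
  · rw [hyperbolaPoints_mulVec_normal, Left.neg_nonpos_iff]
    positivity
  · have hcosh : 1 < Real.cosh (τ l - τ i) :=
      Real.one_lt_cosh.2 (sub_ne_zero.2 (hτ.ne hli))
    simp only [hyperbolaPoints_mulVec_normal, sub_self, Real.cosh_zero]
    linarith

end Hyperbola

theorem fold_neg_one {n d : ℕ} (Z : Matrix (Fin n) (Fin d) ℝ) : fold Z (fun _ => -1) = Z := by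
  ext i j
  simp [fold]

theorem log_mul_div_log_le {a x : ℝ} (ha : 1 < a) (hax : a ≤ x) :
    Real.log a * (x / Real.log x) ≤ x := by
  have ha₀ : 0 < a := one_pos.trans ha
  have hlog : 0 < Real.log x := Real.log_pos (ha.trans_le hax)
  rw [← mul_div_assoc, div_le_iff₀ hlog, mul_comm]
  exact mul_le_mul_of_nonneg_left (Real.log_le_log ha₀ hax) (ha₀.le.trans hax)

end LogisticRegression

theorem corollary1_general (n : ℕ) :
    ∃ (Z : Matrix (Fin n) (Fin 2) ℝ) (Y : Fin n → ℝ), (∀ i, Y i = -1 ∨ Y i = 1) ∧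
      ∀ w : Fin n → ℝ, (∀ i, 0 < w i) → ∀ ε : ℝ, ε < 1 →
        ∀ (k : ℕ) (C : Matrix (Fin k) (Fin 2) ℝ) (u : Fin k → ℝ),
          LogisticRegression.IsCoreset ε (LogisticRegression.fold Z Y) w C u → n ≤ k := by
  refine ⟨LogisticRegression.hyperbolaPoints fun i => (i : ℝ), fun _ => -1, fun _ => Or.inl rfl,
    fun w hw ε hε k C u h => ?_⟩
  rw [LogisticRegression.fold_neg_one] at h
  exact h.le_of_hyperbolaPoints (Nat.cast_injective.comp Fin.val_injective) hw hε

theorem corollary1 :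
    ∃ c : ℝ, 0 < c ∧ ∀ n : ℕ, 2 ≤ n →
      ∃ (Z : Matrix (Fin n) (Fin 2) ℝ) (Y : Fin n → ℝ), (∀ i, Y i = -1 ∨ Y i = 1) ∧
        ∀ ε : ℝ, 0 < ε → ε < 1 →
          ∀ (k : ℕ) (C : Matrix (Fin k) (Fin 2) ℝ) (u : Fin k → ℝ),
            LogisticRegression.IsCoreset ε (LogisticRegression.fold Z Y) (fun _ => 1) C u →
              c * ((n : ℝ) / Real.log (n : ℝ)) ≤ (k : ℝ) := by
  refine ⟨Real.log 2, Real.log_pos one_lt_two, fun n hn => ?_⟩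
  obtain ⟨Z, Y, hY, hcard⟩ := corollary1_general n
  exact ⟨Z, Y, hY, fun ε _ hε k C u h =>
    (LogisticRegression.log_mul_div_log_le one_lt_two (Nat.ofNat_le_cast.2 hn)).trans
      (Nat.cast_le.2 (hcard _ (fun _ => one_pos) ε hε k C u h))⟩
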